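/- For $c>0$ write $f_c(y)=c\,e^{-cy}\mathbf 1(y>0)$, $y\in\mathbb R$. Let $k>0$ with $k\neq 1$, let $\pi$ be the probability measure on $\mathbb R$ with Lebesgue density $f_1$ (also denoted $\pi(\cdot)$), let the proposal density be $q(x,y)=f_1(y)$ (an independence sampler whose proposal is the target), and let $\hat\pi=f_k$ be a surrogate for $\pi$. Set $$\alpha_{MH}(x,y)=1\wedge\frac{\pi(y)q(y,x)}{\pi(x)q(x,y)},\qquad \alpha_{DA}(x,y)=\Big[1\wedge\frac{\hat\pi(y)q(y,x)}{\hat\pi(x)q(x,y)}\Big]\Big[1\wedge\frac{\pi(y)/\hat\pi(y)}{\pi(x)/\hat\pi(x)}\Big],$$ where $1\wedge(\cdot)$ is taken to be $1$ when the denominator of the ratio is $0$ (and $0/0=0$ in the quotients $\pi/\hat\pi$; these conventions matter only on a $\pi$-null set of states). For $\ast\in\{MH,DA\}$ let $$P_\ast(x,dy)=q(x,y)\alpha_\ast(x,y)\,dy+\Big[1-\int q(x,z)\alpha_\ast(x,z)\,dz\Big]\delta_x(dy)$$ be the Metropolis-Hastings (MH) kernel and the delayed-acceptance (DA) kernel.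 For a Markov kernel $P$ that is reversible with respect to $\pi$: * $P$ is geometrically ergodic if there are $\rho<1$ and a finite function $C$ such that, for $\pi$-almost every $x$, $\sup_A|P^n(x,A)-\pi(A)|\le C(x)\rho^n$ for all $n$; * the conductance of $P$ is $\inf\big\{\frac1{\pi(A)}\int_A P(x,A^c)\,\pi(dx): A \text{ measurable},\ 0<\pi(A)\le \tfrac12\big\}$; * $P$ is variance bounding if for every $h\in L^2(\pi)$ the asymptotic variance $\lim_{n\to\infty} n\,\mathrm{Var}\big[\frac1n\sum_{i=1}^n h(X_i)\big]$ is finite, where $(X_i)_{i\ge1}$ is the Markov chain with kernel $P$ and $X_1\sim\pi$. Then $P_{MH}$ and $P_{DA}$ are reversible with respect to $\pi$; $P_{MH}$ is geometrically ergodic; $P_{DA}$ has conductance $0$; and $P_{DA}$ is neither geometrically ergodic nor variance bounding. -/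

import Mathlib

open MeasureTheory ProbabilityTheory Filter
open scoped ENNReal NNReal

namespace DelayedAcceptance

/-- A probability density with respect to the reference measure `lam`. -/
structure ProbDensity {X : Type*} [MeasurableSpace X] (lam : Measure X) where
  dens : X → ℝ
  measurable : Measurable dens
  nonneg : ∀ x, 0 ≤ dens x
  lintegral_eq_one : ∫⁻ x, ENNReal.ofReal (dens x) ∂lam = 1

/-- A proposal density `q(x, y)`: jointly measurable, and a probability density in `y`
for every current value `x`. -/
structure ProposalDensity {X : Type*} [MeasurableSpace X] (lam : Measure X) where
  dens : X → X → ℝ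
  measurable : Measurable (Function.uncurry dens)
  nonneg : ∀ x y, 0 ≤ dens x y
  lintegral_eq_one : ∀ x, ∫⁻ y, ENNReal.ofReal (dens x y) ∂lam = 1

/-- The probability measure with a given density. -/
noncomputable def ProbDensity.measure {X : Type*} [MeasurableSpace X] {lam : Measure X}
    (p : ProbDensity lam) : Measure X :=
  lam.withDensity fun x => ENNReal.ofReal (p.dens x)

instance ProbDensity.instIsProbabilityMeasure {X : Type*} [MeasurableSpace X] {lam : Measure X}
    (p : ProbDensity lam) : IsProbabilityMeasure p.measure :=
  ⟨by
    rw [ProbDensity.measure, withDensity_apply _ MeasurableSet.univ, Measure.restrict_univ]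
    exact p.lintegral_eq_one⟩

/-- The independence-sampler proposal `q(x, y) = q(y)`. -/
def independenceProposal {X : Type*} [MeasurableSpace X] {lam : Measure X}
    (p : ProbDensity lam) : ProposalDensity lam where
  dens := fun _ y => p.dens y
  measurable := p.measurable.comp measurable_snd
  nonneg := fun _ y => p.nonneg y
  lintegral_eq_one := fun _ => p.lintegral_eq_one

/-- A measurable acceptance probability `α(x, y) ∈ [0, 1]`. -/
structure AcceptanceProb (X : Type*) [MeasurableSpace X] where
  prob : X → X → ℝ
  measurable : Measurable (Function.uncurry prob)
  nonneg : ∀ x y, 0 ≤ prob x y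
  le_one : ∀ x y, prob x y ≤ 1

/-- The sub-stochastic density `y ↦ q(x, y) α(x, y)` of an accepted move from `x`. -/
noncomputable def acceptedDensity {X : Type*} [MeasurableSpace X] {lam : Measure X}
    (q : ProposalDensity lam) (a : AcceptanceProb X) (x y : X) : ℝ≥0∞ :=
  ENNReal.ofReal (q.dens x y * a.prob x y)

theorem measurable_acceptedDensity {X : Type*} [MeasurableSpace X] {lam : Measure X}
    (q : ProposalDensity lam) (a : AcceptanceProb X) :
    Measurable (Function.uncurry (acceptedDensity q a)) :=
  (q.measurable.mul a.measurable).ennreal_ofReal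

theorem lintegral_acceptedDensity_le_one {X : Type*} [MeasurableSpace X] {lam : Measure X}
    (q : ProposalDensity lam) (a : AcceptanceProb X) (x : X) :
    ∫⁻ y, acceptedDensity q a x y ∂lam ≤ 1 := by
  rw [← q.lintegral_eq_one x]
  exact lintegral_mono fun y =>
    ENNReal.ofReal_le_ofReal (mul_le_of_le_one_right (q.nonneg x y) (a.le_one x y))

/-- The propose-accept-reject kernel
`P(x, dy) = q(x, y) α(x, y) dy + [1 - ∫ q(x, z) α(x, z) dz] δ_x(dy)`. -/
noncomputable def parKernel {X : Type*} [MeasurableSpace X] {lam : Measure X} [SFinite lam]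
    (q : ProposalDensity lam) (a : AcceptanceProb X) : Kernel X X where
  toFun := fun x => lam.withDensity (acceptedDensity q a x) +
    (1 - ∫⁻ y, acceptedDensity q a x y ∂lam) • Measure.dirac x
  measurable' := by
    have h := measurable_acceptedDensity q a
    refine Measure.measurable_of_measurable_coe _ fun s hs => ?_
    simp only [Measure.add_apply, Measure.smul_apply, smul_eq_mul, withDensity_apply _ hs,
      Measure.dirac_apply' _ hs]
    exact (h.lintegral_prod_right' (ν := lam.restrict s)).add
      ((measurable_const.sub (h.lintegral_prod_right' (ν := lam))).mul
        (measurable_one.indicator hs))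

instance parKernel.instIsMarkovKernel {X : Type*} [MeasurableSpace X] {lam : Measure X}
    [SFinite lam] (q : ProposalDensity lam) (a : AcceptanceProb X) :
    IsMarkovKernel (parKernel q a) :=
  ⟨fun x => ⟨by
    change (lam.withDensity (acceptedDensity q a x) +
      (1 - ∫⁻ y, acceptedDensity q a x y ∂lam) • Measure.dirac x) Set.univ = 1
    rw [Measure.add_apply, withDensity_apply _ MeasurableSet.univ, Measure.restrict_univ,
      Measure.smul_apply, measure_univ, smul_eq_mul, mul_one]
    exact add_tsub_cancel_of_le (lintegral_acceptedDensity_le_one q a x)⟩⟩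

/-- `1 ∧ (num / den)`, with the usual Metropolis-Hastings convention that it is `1` when
`den = 0`. -/
noncomputable def acceptRatio (num den : ℝ) : ℝ :=
  if den = 0 then 1 else min 1 (num / den)

theorem acceptRatio_le_one (num den : ℝ) : acceptRatio num den ≤ 1 := by
  unfold acceptRatio
  split_ifs
  · exact le_rfl
  · exact min_le_left _ _

theorem acceptRatio_nonneg {num den : ℝ} (hn : 0 ≤ num) (hd : 0 ≤ den) :
    0 ≤ acceptRatio num den := by
  unfold acceptRatio
  split_ifs
  · exact zero_le_one
  · exact le_min zero_le_one (div_nonneg hn hd)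

theorem measurable_acceptRatio {Y : Type*} [MeasurableSpace Y] {f g : Y → ℝ}
    (hf : Measurable f) (hg : Measurable g) : Measurable fun y => acceptRatio (f y) (g y) :=
  Measurable.ite (hg (measurableSet_singleton 0)) measurable_const
    (measurable_const.min (hf.div hg))

/-- The Metropolis-Hastings acceptance probability
`1 ∧ π(y) q(y, x) / (π(x) q(x, y))`. -/
noncomputable def mhAcceptance {X : Type*} [MeasurableSpace X] {lam : Measure X}
    (p : ProbDensity lam) (q : ProposalDensity lam) : AcceptanceProb X where
  prob := fun x y => acceptRatio (p.dens y * q.dens y x) (p.dens x * q.dens x y)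
  measurable := measurable_acceptRatio
    ((p.measurable.comp measurable_snd).mul (q.measurable.comp measurable_swap))
    ((p.measurable.comp measurable_fst).mul q.measurable)
  nonneg := fun x y => acceptRatio_nonneg (mul_nonneg (p.nonneg y) (q.nonneg y x))
    (mul_nonneg (p.nonneg x) (q.nonneg x y))
  le_one := fun _ _ => acceptRatio_le_one _ _

/-- The delayed-acceptance acceptance probability, for the target `p` and the surrogate `s`:
`[1 ∧ s(y) q(y, x) / (s(x) q(x, y))] [1 ∧ (p(y) / s(y)) / (p(x) / s(x))]`. -/
noncomputable def daAcceptance {X : Type*} [MeasurableSpace X] {lam : Measure X}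
    (p s : ProbDensity lam) (q : ProposalDensity lam) : AcceptanceProb X where
  prob := fun x y => acceptRatio (s.dens y * q.dens y x) (s.dens x * q.dens x y) *
    acceptRatio (p.dens y / s.dens y) (p.dens x / s.dens x)
  measurable := (mhAcceptance s q).measurable.mul (measurable_acceptRatio
    ((p.measurable.comp measurable_snd).div (s.measurable.comp measurable_snd))
    ((p.measurable.comp measurable_fst).div (s.measurable.comp measurable_fst)))
  nonneg := fun x y => mul_nonneg ((mhAcceptance s q).nonneg x y)
    (acceptRatio_nonneg (div_nonneg (p.nonneg y) (s.nonneg y))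
      (div_nonneg (p.nonneg x) (s.nonneg x)))
  le_one := fun x y => mul_le_one₀ ((mhAcceptance s q).le_one x y)
    (acceptRatio_nonneg (div_nonneg (p.nonneg y) (s.nonneg y))
      (div_nonneg (p.nonneg x) (s.nonneg x))) (acceptRatio_le_one _ _)

/-- The Metropolis-Hastings kernel with target `p` and proposal `q`. -/
noncomputable def mhKernel {X : Type*} [MeasurableSpace X] {lam : Measure X} [SFinite lam]
    (p : ProbDensity lam) (q : ProposalDensity lam) : Kernel X X :=
  parKernel q (mhAcceptance p q)

/-- The delayed-acceptance kernel with target `p`, surrogate `s` and proposal `q`. -/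
noncomputable def daKernel {X : Type*} [MeasurableSpace X] {lam : Measure X} [SFinite lam]
    (p s : ProbDensity lam) (q : ProposalDensity lam) : Kernel X X :=
  parKernel q (daAcceptance p s q)

instance mhKernel.instIsMarkovKernel {X : Type*} [MeasurableSpace X] {lam : Measure X}
    [SFinite lam] (p : ProbDensity lam) (q : ProposalDensity lam) :
    IsMarkovKernel (mhKernel p q) :=
  parKernel.instIsMarkovKernel _ _

instance daKernel.instIsMarkovKernel {X : Type*} [MeasurableSpace X] {lam : Measure X}
    [SFinite lam] (p s : ProbDensity lam) (q : ProposalDensity lam) :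
    IsMarkovKernel (daKernel p s q) :=
  parKernel.instIsMarkovKernel _ _

/-- Total variation distance `sup_A |μ(A) - ν(A)|` of two probability measures. -/
noncomputable def tvDist {X : Type*} [MeasurableSpace X] (μ ν : Measure X) : ℝ≥0∞ :=
  ⨆ (A : Set X) (_ : MeasurableSet A), ENNReal.ofReal |μ.real A - ν.real A|

/-- Geometric ergodicity: there are `ρ < 1` and a finite function `C` such that
`‖Pⁿ(x, ·) - π‖_TV ≤ C(x) ρⁿ` for all `n`, for `π`-almost every `x`. -/
def GeometricallyErgodic {X : Type*} [MeasurableSpace X] (P : Kernel X X) (π : Measure X) :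
    Prop :=
  ∃ ρ : ℝ≥0, ρ < 1 ∧ ∃ C : X → ℝ≥0,
    ∀ᵐ x ∂π, ∀ n : ℕ, tvDist ((P ^ n) x) π ≤ (C x : ℝ≥0∞) * (ρ : ℝ≥0∞) ^ n

/-- The probability `κ(A)` that the stationary chain leaves `A` at the next step, given that
it currently is in `A`. -/
noncomputable def escapeProb {X : Type*} [MeasurableSpace X] (P : Kernel X X) (π : Measure X)
    (A : Set X) : ℝ≥0∞ :=
  (∫⁻ x in A, P x Aᶜ ∂π) / π A

/-- The conductance `inf {κ(A) : 0 < π(A) ≤ 1/2}`. -/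
noncomputable def conductance {X : Type*} [MeasurableSpace X] (P : Kernel X X)
    (π : Measure X) : ℝ≥0∞ :=
  ⨅ (A : Set X) (_ : MeasurableSet A) (_ : 0 < π A) (_ : π A ≤ 1 / 2), escapeProb P π A

/-- The law on path space of the Markov chain with initial law `π` and transition
kernel `P`. -/
noncomputable def chainLaw {X : Type*} [MeasurableSpace X] (P : Kernel X X) [IsMarkovKernel P]
    (π : Measure X) : Measure (ℕ → X) :=
  Kernel.trajMeasure (X := fun _ => X) π
    fun n => P.comap (fun x : (i : Finset.Iic n) → X => x ⟨n, Finset.mem_Iic.2 le_rfl⟩)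
      (measurable_pi_apply _)

/-- The asymptotic variance `lim n Var[(1/n) ∑_{i < n} h(X_i)]`, with values in `[0, ∞]`, of
the chain started from `π`. It is written as an upper limit, so that it is the limit whenever
the limit exists, as it always does for a reversible chain and `h ∈ L²(π)`. -/
noncomputable def asymptoticVariance {X : Type*} [MeasurableSpace X] (P : Kernel X X)
    [IsMarkovKernel P] (π : Measure X) (h : X → ℝ) : ℝ≥0∞ :=
  limsup (fun n : ℕ => (n : ℝ≥0∞) *
    evariance (fun ω : ℕ → X => (n : ℝ)⁻¹ * ∑ i ∈ Finset.range n, h (ω i)) (chainLaw P π)) atTop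

/-- Variance bounding: every square-integrable functional has finite asymptotic variance. -/
def VarianceBounding {X : Type*} [MeasurableSpace X] (P : Kernel X X) [IsMarkovKernel P]
    (π : Measure X) : Prop :=
  ∀ h : X → ℝ, MemLp h 2 π → asymptoticVariance P π h < ⊤

/-- The exponential density `k e^{-ky} 1(y > 0)` on the real line. -/
noncomputable def expDensity (k : ℝ) (hk : 0 < k) : ProbDensity (volume : Measure ℝ) where
  dens := fun y => if 0 < y then k * Real.exp (-(k * y)) else 0
  measurable := Measurable.ite measurableSet_Ioi (by fun_prop) measurable_const
  nonneg := fun y => by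
    split_ifs
    · positivity
    · exact le_rfl
  lintegral_eq_one := by
    rw [← lintegral_exponentialPDF_eq_one hk]
    refine lintegral_congr_ae ?_
    filter_upwards [Measure.ae_ne volume (0 : ℝ)] with y hy
    rw [exponentialPDF_eq]
    rcases lt_or_gt_of_ne hy with h | h
    · simp [h.not_gt, h.not_ge]
    · simp [h, h.le]

/-- The law with density `e^{-y} 1(y > 0)`. -/
noncomputable abbrev expLaw : Measure ℝ := (expDensity 1 one_pos).measure

/-- The Metropolis-Hastings independence sampler with target and proposal `e^{-y} 1(y > 0)`. -/
noncomputable abbrev expMH : Kernel ℝ ℝ :=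
  mhKernel (expDensity 1 one_pos) (independenceProposal (expDensity 1 one_pos))

/-- The corresponding delayed-acceptance kernel with surrogate `k e^{-ky} 1(y > 0)`. -/
noncomputable abbrev expDA (k : ℝ) (hk : 0 < k) : Kernel ℝ ℝ :=
  daKernel (expDensity 1 one_pos) (expDensity k hk)
    (independenceProposal (expDensity 1 one_pos))

end DelayedAcceptance

/-! Since the proposal is the target, every MH move is accepted and `expMH x` is `expLaw` itself:
independent sampling. For DA on the positive half-line, the two stage ratios are `exp ((1 - k) (y -
x))` and its inverse; one truncation is inactive, so the product is `exp (-|1 - k| |y - x|)`, which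
is symmetric and gives detailed balance.

From a large `x`, either the proposal exceeds `x / 2`, with probability `exp (-x / 2)`, or it lies
at distance at least `x / 2` and is accepted with probability at most `exp (-|1 - k| x / 2)`. Hence
the chain moves with probability at most `2 exp (-β x)`, where `β = min (|1 - k| / 2) (1 / 2)`
(`lintegral_acceptedDensity_expDA_le`).

All the negative results follow from this stickiness. Tails `(t, ∞)` have escape probability tending
to 0. Holding probabilities approach 1 while `expLaw` has no atoms, which excludes every geometric
rate. Finally, for `h x = exp (γ x)` with `γ` just below `1 / 2`, paths frozen for `n` steps in a
tail chosen according to `n` already make the scaled variance at least of order `√n`. -/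

namespace DelayedAcceptance

/-! ### Propose-accept-reject kernels, total variation and geometric ergodicity. -/

section General

variable {X : Type*} [MeasurableSpace X]

theorem parKernel_apply {lam : Measure X} [SFinite lam] (q : ProposalDensity lam)
    (a : AcceptanceProb X) (x : X) {s : Set X} (hs : MeasurableSet s) :
    parKernel q a x s = ∫⁻ y in s, acceptedDensity q a x y ∂lam +
      (1 - ∫⁻ y, acceptedDensity q a x y ∂lam) * s.indicator 1 x := by
  change (lam.withDensity (acceptedDensity q a x) +
      (1 - ∫⁻ y, acceptedDensity q a x y ∂lam) • Measure.dirac x) s = _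
  rw [Measure.add_apply, Measure.smul_apply, smul_eq_mul, withDensity_apply _ hs,
    Measure.dirac_apply' _ hs]

/-- The kernel leaves its current state at most as often as a proposal is accepted. -/
theorem parKernel_apply_le_of_notMem {lam : Measure X} [SFinite lam] (q : ProposalDensity lam)
    (a : AcceptanceProb X) {x : X} {s : Set X} (hs : MeasurableSet s) (hx : x ∉ s) :
    parKernel q a x s ≤ ∫⁻ y, acceptedDensity q a x y ∂lam := by
  rw [parKernel_apply q a x hs, Set.indicator_of_notMem hx, mul_zero, add_zero]
  exact setLIntegral_le_lintegral _ _

theorem le_parKernel_singleton [MeasurableSingletonClass X] {lam : Measure X} [SFinite lam]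
    (q : ProposalDensity lam) (a : AcceptanceProb X) (x : X) :
    1 - ∫⁻ y, acceptedDensity q a x y ∂lam ≤ parKernel q a x {x} := by
  rw [parKernel_apply q a x (measurableSet_singleton x)]
  simp

/-- Detailed balance of the accepted moves gives reversibility. -/
theorem parKernel_isReversible {lam : Measure X} [SFinite lam] (p : ProbDensity lam)
    (q : ProposalDensity lam) (a : AcceptanceProb X)
    (h : ∀ x y, p.dens x * (q.dens x y * a.prob x y) = p.dens y * (q.dens y x * a.prob y x)) :
    (parKernel q a).IsReversible p.measure := by
  have hm := measurable_acceptedDensity q a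
  have hp : Measurable fun x => ENNReal.ofReal (p.dens x) := p.measurable.ennreal_ofReal
  have hg : Measurable fun x => 1 - ∫⁻ y, acceptedDensity q a x y ∂lam :=
    measurable_const.sub (hm.lintegral_prod_right' (ν := lam))
  -- The rejected part of the flow from `A` to `B` lives on `A ∩ B`, so it is symmetric; only the
  -- accepted part needs detailed balance.
  have hflow : ∀ A B : Set X, MeasurableSet A → MeasurableSet B →
      ∫⁻ x in A, parKernel q a x B ∂p.measure =
        (∫⁻ x in A, ∫⁻ y in B, ENNReal.ofReal (p.dens x) * acceptedDensity q a x y ∂lam ∂lam) +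
          ∫⁻ x in A ∩ B, (1 - ∫⁻ y, acceptedDensity q a x y ∂lam) ∂p.measure := by
    intro A B hA hB
    have h1 : Measurable fun x => ∫⁻ y in B, acceptedDensity q a x y ∂lam :=
      hm.lintegral_prod_right' (ν := lam.restrict B)
    simp_rw [parKernel_apply q a _ hB]
    rw [lintegral_add_left h1]
    congr 1
    · rw [ProbDensity.measure, setLIntegral_withDensity_eq_setLIntegral_mul _ hp h1 hA]
      refine lintegral_congr fun x => ?_
      rw [Pi.mul_apply, lintegral_const_mul]
      exact hm.comp measurable_prodMk_left
    · rw [Set.inter_comm, ← setLIntegral_indicator hB]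
      refine lintegral_congr fun x => ?_
      by_cases hx : x ∈ B <;> simp [hx]
  intro A B hA hB
  rw [hflow A B hA hB, hflow B A hB hA, Set.inter_comm B A, lintegral_lintegral_swap]
  · congr 1
    refine lintegral_congr fun y => lintegral_congr fun x => ?_
    simp only [acceptedDensity]
    rw [← ENNReal.ofReal_mul (p.nonneg _), ← ENNReal.ofReal_mul (p.nonneg _), h]
  · exact ((hp.comp measurable_fst).mul hm).aemeasurable

theorem isMarkovKernel_pow (P : Kernel X X) [IsMarkovKernel P] (n : ℕ) :
    IsMarkovKernel (P ^ n) := by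
  induction n with
  | zero => exact inferInstanceAs (IsMarkovKernel Kernel.id)
  | succ n ih => exact inferInstanceAs (IsMarkovKernel ((P ^ n) ∘ₖ P))

/-- One way to be at `x` after `n` steps is never to have left it. -/
theorem pow_singleton_le_pow_apply [MeasurableSingletonClass X] (P : Kernel X X) (x : X)
    (n : ℕ) : (P x {x}) ^ n ≤ (P ^ n) x {x} := by
  induction n with
  | zero =>
    change _ ≤ Kernel.id x {x}
    simp [Kernel.id_apply]
  | succ n ih =>
    rw [Kernel.pow_succ_apply_eq_lintegral _ _ _ (measurableSet_singleton x), pow_succ, mul_comm]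
    calc P x {x} * P x {x} ^ n ≤ P x {x} * (P ^ n) x {x} := by gcongr
      _ = ∫⁻ b in {x}, P b {x} ∂((P ^ n) x) := by rw [lintegral_singleton]
      _ ≤ _ := setLIntegral_le_lintegral _ _

theorem tvDist_self (μ : Measure X) : tvDist μ μ = 0 := by simp [tvDist]

theorem tvDist_le_one (μ ν : Measure X) [IsProbabilityMeasure μ] [IsProbabilityMeasure ν] :
    tvDist μ ν ≤ 1 := by
  refine iSup₂_le fun A _ => ?_
  rw [← ENNReal.ofReal_one]
  refine ENNReal.ofReal_le_ofReal (abs_sub_le_iff.2 ⟨?_, ?_⟩) <;>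
    linarith [measureReal_nonneg (μ := μ) (s := A), measureReal_nonneg (μ := ν) (s := A),
      measureReal_le_one (μ := μ) (s := A), measureReal_le_one (μ := ν) (s := A)]

theorem measure_le_tvDist {μ ν : Measure X} [IsFiniteMeasure μ] {A : Set X}
    (hA : MeasurableSet A) (hν : ν A = 0) : μ A ≤ tvDist μ ν := by
  refine le_trans ?_ (le_iSup₂ (f := fun (A : Set X) (_ : MeasurableSet A) =>
    ENNReal.ofReal |μ.real A - ν.real A|) A hA)
  simp [measureReal_def, hν]

/-- Independent sampling from `π` is geometrically ergodic. -/
theorem geometricallyErgodic_of_apply_eq (P : Kernel X X) [IsMarkovKernel P] (π : Measure X)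
    [IsProbabilityMeasure π] (h : ∀ x, P x = π) : GeometricallyErgodic P π := by
  -- Rate 0 works: `0 ^ 0 = 1` covers the trivial bound at `n = 0`, and the distance vanishes from
  -- `n = 1` on.
  refine ⟨0, zero_lt_one, fun _ => 1, ae_of_all _ fun x n => ?_⟩
  have := isMarkovKernel_pow P n
  have hle : tvDist ((P ^ n) x) π ≤ 1 := tvDist_le_one _ _
  rcases n.eq_zero_or_pos with hn | hn
  · rw [hn] at hle ⊢
    rwa [pow_zero (M := ℝ≥0∞), ENNReal.coe_one, one_mul]
  · obtain ⟨m, rfl⟩ := Nat.exists_eq_add_of_le' hn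
    have := isMarkovKernel_pow P m
    have hpow : (P ^ (m + 1)) x = π := by
      ext s hs
      rw [Kernel.pow_succ_apply_eq_lintegral _ _ _ hs]
      simp [h]
    rw [hpow, tvDist_self]
    exact zero_le

/-- A chain whose holding probability is within `1 - ρ` of one with positive probability, at
states that are not atoms of `π`, converges at no geometric rate `ρ`. -/
theorem not_geometricallyErgodic_of_sticky [MeasurableSingletonClass X] (P : Kernel X X)
    [IsMarkovKernel P] (π : Measure X) [NullSingletonClass π]
    (h : ∀ ρ : ℝ≥0, ρ < 1 → ∃ A : Set X, π A ≠ 0 ∧ ∀ x ∈ A, (ρ : ℝ≥0∞) < P x {x}) :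
    ¬ GeometricallyErgodic P π := by
  rintro ⟨ρ, hρ, C, hC⟩
  obtain ⟨A, hA, hAP⟩ := h ρ hρ
  obtain ⟨x, hxA, hx⟩ := ((frequently_ae_mem_iff.2 hA).and_eventually hC).exists
  have := isMarkovKernel_pow P
  have hb : ∀ n : ℕ, (P x {x}) ^ n ≤ C x * (ρ : ℝ≥0∞) ^ n := fun n =>
    (pow_singleton_le_pow_apply P x n).trans
      ((measure_le_tvDist (measurableSet_singleton x) (measure_singleton x)).trans (hx n))
  have hlt := hAP x hxA
  generalize P x {x} = s at hb hlt
  have hs : s ≠ ⊤ := by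
    rintro rfl
    simpa [ENNReal.mul_eq_top] using hb 1
  lift s to ℝ≥0 using hs
  rw [ENNReal.coe_lt_coe] at hlt
  -- Dividing by `s ^ n` turns the bound into one by a sequence tending to 0, as `ρ < s`.
  have hb' : ∀ n : ℕ, 1 ≤ C x * (ρ / s) ^ n := by
    intro n
    have h1 : s ^ n ≤ C x * ρ ^ n := by exact_mod_cast hb n
    have h2 : 0 < s ^ n := pow_pos (bot_lt_of_lt hlt) n
    rw [div_pow, mul_div_assoc', one_le_div h2]
    exact h1
  have hlim : Tendsto (fun n : ℕ => C x * (ρ / s) ^ n) atTop (nhds (C x * 0)) :=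
    (tendsto_pow_atTop_nhds_zero_of_lt_one zero_le
      ((div_lt_one (bot_lt_of_lt hlt)).2 hlt)).const_mul _
  have := ge_of_tendsto' hlim hb'
  simp at this

end General

/-! ### The stationary chain on path space and its frozen paths. -/

section Chain

variable {X : Type*} [MeasurableSpace X] (P : Kernel X X) [IsMarkovKernel P] (π : Measure X)

instance chainLaw.instIsProbabilityMeasure [IsProbabilityMeasure π] : IsProbabilityMeasure (chainLaw P π) :=
  inferInstanceAs (IsProbabilityMeasure (Kernel.trajMeasure (X := fun _ => X) π _))

/-- The Markov property, in the form used by the inductions on time. -/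
theorem chainLaw_map_prod_succ [IsProbabilityMeasure π] (n : ℕ) :
    (chainLaw P π).map (fun ω => (Preorder.frestrictLe n ω, ω (n + 1))) =
      (chainLaw P π).map (Preorder.frestrictLe n) ⊗ₘ
        P.comap (fun x : (i : Finset.Iic n) → X => x ⟨n, Finset.mem_Iic.2 le_rfl⟩)
          (measurable_pi_apply _) :=
  (Kernel.map_frestrictLe_trajMeasure_compProd_eq_map_trajMeasure (X := fun _ => X)).symm

theorem chainLaw_map_zero : (chainLaw P π).map (fun ω => ω 0) = π := by
  have h : (fun ω : ℕ → X => ω 0) =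
      (fun x : (i : Finset.Iic 0) → X => x ⟨0, Finset.mem_Iic.2 le_rfl⟩) ∘
        Preorder.frestrictLe (π := fun _ => X) 0 := rfl
  rw [h, ← Measure.map_map (measurable_pi_apply _) (by fun_prop), chainLaw, Kernel.trajMeasure,
    Measure.map_comp _ _ (by fun_prop), Kernel.traj_map_frestrictLe, Kernel.partialTraj_self,
    Measure.id_comp, Measure.map_map (measurable_pi_apply _) (by fun_prop)]
  exact Measure.map_id

variable {P π} [IsProbabilityMeasure π]

/-- A chain started from an invariant law is stationary. -/
theorem chainLaw_map_eval (hP : Kernel.Invariant P π) (n : ℕ) :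
    (chainLaw P π).map (fun ω => ω n) = π := by
  induction n with
  | zero => exact chainLaw_map_zero P π
  | succ n ih =>
    have h1 : (chainLaw P π).map (fun ω => ω (n + 1)) =
        ((chainLaw P π).map (fun ω => (Preorder.frestrictLe n ω, ω (n + 1)))).snd := by
      rw [Measure.snd, Measure.map_map measurable_snd (by fun_prop)]
      rfl
    ext s hs
    rw [h1, chainLaw_map_prod_succ, Measure.snd_apply hs,
      Measure.compProd_apply (measurable_snd hs), lintegral_map]
    · change ∫⁻ ω, P (ω n) s ∂chainLaw P π = π s
      rw [← lintegral_map (f := fun x => P x s) (P.measurable_coe hs) (measurable_pi_apply n), ih,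
        ← Measure.bind_apply hs P.aemeasurable]
      exact congrArg (· s) hP
    · exact Kernel.measurable_kernel_prodMk_left (measurable_snd hs)
    · fun_prop

/-- Lower bound on the probability that the chain starts in `A` and stays put for `n` steps. -/
theorem pow_mul_le_chainLaw_stuck [MeasurableSingletonClass X] [MeasurableEq X] {A : Set X}
    (hA : MeasurableSet A) {b : ℝ≥0∞} (hb : ∀ x ∈ A, b ≤ P x {x}) (n : ℕ) :
    b ^ n * π A ≤ chainLaw P π {ω | ω 0 ∈ A ∧ ∀ i ≤ n, ω i = ω 0} := by
  induction n with
  | zero =>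
    have h : chainLaw P π ((fun ω => ω 0) ⁻¹' A) = π A := by
      rw [← Measure.map_apply (by fun_prop) hA, chainLaw_map_zero]
    rw [pow_zero, one_mul, ← h]
    refine measure_mono fun ω hω => ⟨hω, fun i hi => by rw [Nat.le_zero.1 hi]⟩
  | succ n ih =>
    set z : Finset.Iic n := ⟨0, Finset.mem_Iic.2 n.zero_le⟩
    set l : Finset.Iic n := ⟨n, Finset.mem_Iic.2 le_rfl⟩
    set S : Set ((i : Finset.Iic n) → X) := {x | x z ∈ A ∧ ∀ i, x i = x z} with hSdef
    have hS : MeasurableSet S := by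
      have hSi : S = (fun x => x z) ⁻¹' A ∩ ⋂ i, {x | x i = x z} := by
        ext x
        simp [hSdef]
      rw [hSi]
      exact (measurable_pi_apply z hA).inter (MeasurableSet.iInter fun i =>
        measurableSet_eq_fun (measurable_pi_apply i) (measurable_pi_apply z))
    -- The new state is compared with the last one, not the initial one: the slice of `T` over a
    -- history in `S` is then `{x l}`, to which `hb` applies.
    set T : Set (((i : Finset.Iic n) → X) × X) := {w | w.1 ∈ S ∧ w.2 = w.1 l} with hTdef
    have hT : MeasurableSet T := (measurable_fst hS).inter
      (measurableSet_eq_fun measurable_snd ((measurable_pi_apply l).comp measurable_fst))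
    have hpre : {ω : ℕ → X | ω 0 ∈ A ∧ ∀ i ≤ n, ω i = ω 0} =
        Preorder.frestrictLe (π := fun _ => X) n ⁻¹' S := by
      ext ω
      simp [hSdef, z]
    calc b ^ (n + 1) * π A = b * (b ^ n * π A) := by rw [pow_succ']; ring
      _ ≤ b * (chainLaw P π).map (Preorder.frestrictLe n) S := by
        rw [Measure.map_apply (by fun_prop) hS, ← hpre]
        gcongr
      _ = ∫⁻ x in S, b ∂(chainLaw P π).map (Preorder.frestrictLe n) := by
        rw [setLIntegral_const]
      _ ≤ ∫⁻ x in S, P (x l) (Prod.mk x ⁻¹' T) ∂(chainLaw P π).map (Preorder.frestrictLe n) := by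
        refine setLIntegral_mono' hS fun x hx => ?_
        have hxT : Prod.mk x ⁻¹' T = {x l} := by
          ext y
          simp [hTdef, hx]
        rw [hxT]
        refine hb _ ?_
        rw [hx.2 l]
        exact hx.1
      _ ≤ ∫⁻ x, P (x l) (Prod.mk x ⁻¹' T) ∂(chainLaw P π).map (Preorder.frestrictLe n) :=
        setLIntegral_le_lintegral _ _
      _ = (chainLaw P π).map (fun ω => (Preorder.frestrictLe n ω, ω (n + 1))) T := by
        rw [chainLaw_map_prod_succ, Measure.compProd_apply hT]
        rfl
      _ = chainLaw P π ((fun ω => (Preorder.frestrictLe n ω, ω (n + 1))) ⁻¹' T) :=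
        Measure.map_apply (by fun_prop) hT
      _ ≤ _ := by
        refine measure_mono fun ω hω => ?_
        obtain ⟨⟨h0, h1⟩, h2⟩ := hω
        refine ⟨h0, fun i hi => ?_⟩
        rcases Nat.le_succ_iff.1 hi with hi | rfl
        · exact h1 ⟨i, Finset.mem_Iic.2 hi⟩
        · exact Eq.trans h2 (h1 l)

theorem integral_mean_chainLaw (hP : Kernel.Invariant P π) {h : X → ℝ} (hh : Integrable h π)
    (n : ℕ) :
    ∫ ω, ((n + 1 : ℕ) : ℝ)⁻¹ * ∑ i ∈ Finset.range (n + 1), h (ω i) ∂chainLaw P π =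
      ∫ x, h x ∂π := by
  have hmp : ∀ i, MeasurePreserving (fun ω : ℕ → X => ω i) (chainLaw P π) π := fun i =>
    ⟨measurable_pi_apply i, chainLaw_map_eval hP i⟩
  have hint : ∀ i, Integrable (fun ω : ℕ → X => h (ω i)) (chainLaw P π) := fun i =>
    (hmp i).integrable_comp_of_integrable hh
  have hi : ∀ i, ∫ ω, h (ω i) ∂chainLaw P π = ∫ x, h x ∂π := by
    intro i
    conv_rhs => rw [← chainLaw_map_eval hP i]
    rw [integral_map (measurable_pi_apply i).aemeasurable]
    rw [chainLaw_map_eval hP i]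
    exact hh.aestronglyMeasurable
  rw [integral_const_mul, integral_finsetSum _ fun i _ => hint i]
  simp_rw [hi]
  rw [Finset.sum_const, Finset.card_range, nsmul_eq_mul, inv_mul_cancel_left₀]
  exact_mod_cast n.succ_ne_zero

/-- Paths that stay put at a state far from the mean contribute to the variance of the
ergodic average. -/
theorem le_evariance_mean_of_sticky [MeasurableSingletonClass X] [MeasurableEq X]
    (hP : Kernel.Invariant P π) {h : X → ℝ} (hh : Integrable h π) {A : Set X}
    (hA : MeasurableSet A) {b : ℝ≥0∞} (hb : ∀ x ∈ A, b ≤ P x {x}) {r : ℝ}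
    (hr : ∀ x ∈ A, r ≤ h x - ∫ y, h y ∂π) (n : ℕ) :
    ENNReal.ofReal r ^ 2 * (b ^ n * π A) ≤
      evariance (fun ω : ℕ → X => ((n + 1 : ℕ) : ℝ)⁻¹ * ∑ i ∈ Finset.range (n + 1), h (ω i))
        (chainLaw P π) := by
  have hS : MeasurableSet {ω : ℕ → X | ω 0 ∈ A ∧ ∀ i ≤ n, ω i = ω 0} := by
    have hSi : {ω : ℕ → X | ω 0 ∈ A ∧ ∀ i ≤ n, ω i = ω 0} =
        (fun ω : ℕ → X => ω 0) ⁻¹' A ∩ ⋂ i, ⋂ _ : i ≤ n, {ω | ω i = ω 0} := by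
      ext ω
      simp
    rw [hSi]
    exact (measurable_pi_apply 0 hA).inter (MeasurableSet.iInter fun i =>
      MeasurableSet.iInter fun _ =>
        measurableSet_eq_fun (measurable_pi_apply i) (measurable_pi_apply 0))
  rw [evariance, integral_mean_chainLaw hP hh]
  calc ENNReal.ofReal r ^ 2 * (b ^ n * π A)
      ≤ ENNReal.ofReal r ^ 2 * chainLaw P π {ω | ω 0 ∈ A ∧ ∀ i ≤ n, ω i = ω 0} := by
        gcongr
        exact pow_mul_le_chainLaw_stuck hA hb n
    _ = ∫⁻ ω in {ω | ω 0 ∈ A ∧ ∀ i ≤ n, ω i = ω 0}, ENNReal.ofReal r ^ 2 ∂chainLaw P π := by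
        rw [setLIntegral_const]
    _ ≤ ∫⁻ ω in {ω | ω 0 ∈ A ∧ ∀ i ≤ n, ω i = ω 0},
          ‖((n + 1 : ℕ) : ℝ)⁻¹ * ∑ i ∈ Finset.range (n + 1), h (ω i) - ∫ x, h x ∂π‖ₑ ^ 2
            ∂chainLaw P π := by
        refine setLIntegral_mono' hS fun ω hω => ?_
        -- On a frozen path the average is `h (ω 0)`; `n + 1` samples require only `n` holds.
        have hsum : ∑ i ∈ Finset.range (n + 1), h (ω i) = ((n + 1 : ℕ) : ℝ) * h (ω 0) := by
          rw [Finset.sum_congr rfl fun i hi => by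
            rw [hω.2 i (Nat.lt_succ_iff.1 (Finset.mem_range.1 hi))], Finset.sum_const,
            Finset.card_range, nsmul_eq_mul]
        rw [hsum, inv_mul_cancel_left₀ (by exact_mod_cast n.succ_ne_zero)]
        gcongr
        rw [← ofReal_norm]
        exact ENNReal.ofReal_le_ofReal ((hr _ hω.1).trans (Real.le_norm_self _))
    _ ≤ _ := setLIntegral_le_lintegral _ _

end Chain
end DelayedAcceptance

/-! ### The exponential target: acceptance probabilities and their decay. -/

namespace DelayedAcceptance

instance expLaw.instNullSingletonClass : NullSingletonClass expLaw :=
  nullSingletonClass_withDensity _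

theorem expDensity_dens_of_pos {k : ℝ} (hk : 0 < k) {y : ℝ} (hy : 0 < y) :
    (expDensity k hk).dens y = k * Real.exp (-(k * y)) := if_pos hy

theorem expDensity_dens_of_nonpos {k : ℝ} (hk : 0 < k) {y : ℝ} (hy : y ≤ 0) :
    (expDensity k hk).dens y = 0 := if_neg hy.not_gt

theorem expDensity_one_dens_of_pos {y : ℝ} (hy : 0 < y) :
    (expDensity 1 one_pos).dens y = Real.exp (-y) := by
  rw [expDensity_dens_of_pos _ hy, one_mul, one_mul]

theorem expLaw_Ioi {t : ℝ} (ht : 0 ≤ t) :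
    expLaw (Set.Ioi t) = ENNReal.ofReal (Real.exp (-t)) := by
  rw [expLaw, ProbDensity.measure, withDensity_apply _ measurableSet_Ioi, ← integral_exp_neg_Ioi,
    ofReal_integral_eq_lintegral_ofReal]
  · refine setLIntegral_congr_fun measurableSet_Ioi fun y hy => ?_
    simp only [expDensity_one_dens_of_pos (ht.trans_lt hy)]
  · have h := exp_neg_integrableOn_Ioi t one_pos
    simp only [neg_one_mul] at h
    exact h
  · exact ae_of_all _ fun y => (Real.exp_pos _).le

theorem expMH_apply (x : ℝ) : expMH x = expLaw := by
  have hacc : ∀ y, acceptedDensity (independenceProposal (expDensity 1 one_pos))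
      (mhAcceptance (expDensity 1 one_pos) (independenceProposal (expDensity 1 one_pos))) x y =
        ENNReal.ofReal ((expDensity 1 one_pos).dens y) := by
    intro y
    -- Where the densities vanish, the convention for a zero denominator supplies the value 1.
    have hone : ∀ a b : ℝ, acceptRatio (a * b) (b * a) = 1 := by
      intro a b
      unfold acceptRatio
      split_ifs with h
      · rfl
      · rw [mul_comm a b, div_self h, min_self]
    simp [acceptedDensity, mhAcceptance, independenceProposal, hone]
  ext s hs
  rw [expMH, mhKernel, parKernel_apply _ _ _ hs]
  simp_rw [hacc]
  rw [(expDensity 1 one_pos).lintegral_eq_one, tsub_self, zero_mul, add_zero, expLaw,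
    ProbDensity.measure, withDensity_apply _ hs]

variable {k : ℝ} (hk : 0 < k)

/-- Both stages together accept a move from `x` to `y` with probability `exp (-|1 - k| |y - x|)`. -/
theorem daAcceptance_expDensity {x y : ℝ} (hx : 0 < x) (hy : 0 < y) :
    (daAcceptance (expDensity 1 one_pos) (expDensity k hk)
      (independenceProposal (expDensity 1 one_pos))).prob x y =
        Real.exp (-(|1 - k| * |y - x|)) := by
  have hratio : ∀ u v w z : ℝ, acceptRatio (u * Real.exp v) (u * Real.exp w) = z → u ≠ 0 →
      z = min 1 (Real.exp (v - w)) := by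
    rintro u v w z rfl hu
    rw [acceptRatio, if_neg (by positivity), mul_div_mul_left _ _ hu, Real.exp_sub]
  have h1 : acceptRatio ((expDensity k hk).dens y * (expDensity 1 one_pos).dens x)
      ((expDensity k hk).dens x * (expDensity 1 one_pos).dens y) =
        min 1 (Real.exp ((1 - k) * (y - x))) := by
    rw [expDensity_dens_of_pos hk hx, expDensity_dens_of_pos hk hy, expDensity_one_dens_of_pos hx,
      expDensity_one_dens_of_pos hy, mul_assoc, mul_assoc, ← Real.exp_add, ← Real.exp_add,
      hratio _ _ _ _ rfl hk.ne']
    ring_nf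
  have h2 : acceptRatio ((expDensity 1 one_pos).dens y / (expDensity k hk).dens y)
      ((expDensity 1 one_pos).dens x / (expDensity k hk).dens x) =
        min 1 (Real.exp (-((1 - k) * (y - x)))) := by
    have hquot : ∀ z : ℝ, Real.exp (-z) / (k * Real.exp (-(k * z))) =
        k⁻¹ * Real.exp (-z + k * z) := by
      intro z
      rw [Real.exp_add, Real.exp_neg (k * z)]
      field_simp
    rw [expDensity_dens_of_pos hk hx, expDensity_dens_of_pos hk hy, expDensity_one_dens_of_pos hx,
      expDensity_one_dens_of_pos hy, hquot, hquot, hratio _ _ _ _ rfl (inv_ne_zero hk.ne')]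
    ring_nf
  have h3 : ∀ u : ℝ, min 1 (Real.exp u) * min 1 (Real.exp (-u)) = Real.exp (-|u|) := by
    intro u
    rcases le_total 0 u with hu | hu
    · rw [min_eq_left (Real.one_le_exp hu), min_eq_right (Real.exp_le_one_iff.2 (by linarith)),
        abs_of_nonneg hu, one_mul]
    · rw [min_eq_right (Real.exp_le_one_iff.2 hu), min_eq_left (Real.one_le_exp (by linarith)),
        abs_of_nonpos hu, mul_one, neg_neg]
  change acceptRatio ((expDensity k hk).dens y * (expDensity 1 one_pos).dens x)
      ((expDensity k hk).dens x * (expDensity 1 one_pos).dens y) * acceptRatio _ _ = _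
  rw [h1, h2, h3, abs_mul]

/-- The acceptance probability is symmetric on positive states; elsewhere a vanishing density makes
both sides 0. -/
theorem expDA_isReversible : (expDA k hk).IsReversible expLaw := by
  refine parKernel_isReversible _ _ _ fun x y => ?_
  change (expDensity 1 one_pos).dens x * ((expDensity 1 one_pos).dens y * _) =
    (expDensity 1 one_pos).dens y * ((expDensity 1 one_pos).dens x * _)
  rcases le_or_gt x 0 with hx | hx
  · simp [expDensity_dens_of_nonpos one_pos hx]
  rcases le_or_gt y 0 with hy | hy
  · simp [expDensity_dens_of_nonpos one_pos hy]
  rw [daAcceptance_expDensity hk hx hy, daAcceptance_expDensity hk hy hx, abs_sub_comm y x]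
  ring

/-- The overall acceptance probability at `x` decays exponentially in `x`. -/
theorem lintegral_acceptedDensity_expDA_le {β : ℝ} (hβk : β ≤ |1 - k| / 2) (hβ : β ≤ 1 / 2)
    {x : ℝ} (hx : 0 < x) :
    ∫⁻ y, acceptedDensity (independenceProposal (expDensity 1 one_pos))
      (daAcceptance (expDensity 1 one_pos) (expDensity k hk)
        (independenceProposal (expDensity 1 one_pos))) x y ≤
      ENNReal.ofReal (2 * Real.exp (-(β * x))) := by
  set a := daAcceptance (expDensity 1 one_pos) (expDensity k hk)
        (independenceProposal (expDensity 1 one_pos)) with ha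
  -- Split at `x / 2`: below it the distance to `x` makes acceptance small, above it the proposal
  -- itself is rare.
  have hbound : ∀ y, acceptedDensity (independenceProposal (expDensity 1 one_pos)) a x y ≤
      ENNReal.ofReal (Real.exp (-(β * x))) * ENNReal.ofReal ((expDensity 1 one_pos).dens y) +
        (Set.Ioi (x / 2)).indicator
          (fun y => ENNReal.ofReal ((expDensity 1 one_pos).dens y)) y := by
    intro y
    change ENNReal.ofReal ((expDensity 1 one_pos).dens y * a.prob x y) ≤ _
    rcases le_or_gt y 0 with hy | hy
    · simp [expDensity_dens_of_nonpos one_pos hy]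
    by_cases hxy : y ∈ Set.Ioi (x / 2)
    · rw [Set.indicator_of_mem hxy]
      refine le_add_left (ENNReal.ofReal_le_ofReal ?_)
      exact mul_le_of_le_one_right ((expDensity 1 one_pos).nonneg y) (a.le_one x y)
    · refine le_add_right ?_
      rw [← ENNReal.ofReal_mul (Real.exp_pos _).le, mul_comm (Real.exp _)]
      refine ENNReal.ofReal_le_ofReal
        (mul_le_mul_of_nonneg_left ?_ ((expDensity 1 one_pos).nonneg y))
      rw [ha, daAcceptance_expDensity hk hx hy]
      have hy2 : y ≤ x / 2 := not_lt.1 hxy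
      refine Real.exp_le_exp.2 (neg_le_neg ?_)
      calc β * x ≤ |1 - k| / 2 * x := by gcongr
        _ = |1 - k| * (x / 2) := by ring
        _ ≤ |1 - k| * |y - x| := by
          gcongr
          rw [abs_sub_comm]
          exact le_trans (by linarith) (le_abs_self _)
  refine (lintegral_mono hbound).trans ?_
  have hm : Measurable fun y => ENNReal.ofReal ((expDensity 1 one_pos).dens y) :=
    (expDensity 1 one_pos).measurable.ennreal_ofReal
  rw [lintegral_add_left (hm.const_mul _), lintegral_const_mul _ hm,
    (expDensity 1 one_pos).lintegral_eq_one, lintegral_indicator measurableSet_Ioi,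
    ← withDensity_apply _ measurableSet_Ioi, mul_one, two_mul,
    ENNReal.ofReal_add (Real.exp_pos _).le (Real.exp_pos _).le]
  gcongr
  have := expLaw_Ioi (t := x / 2) (by positivity)
  rw [expLaw, ProbDensity.measure] at this
  rw [this]
  refine ENNReal.ofReal_le_ofReal (Real.exp_le_exp.2 (neg_le_neg ?_))
  nlinarith

theorem expDA_apply_le_of_notMem {β : ℝ} (hβk : β ≤ |1 - k| / 2) (hβ : β ≤ 1 / 2)
    {x : ℝ} (hx : 0 < x) {s : Set ℝ} (hs : MeasurableSet s) (hxs : x ∉ s) :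
    expDA k hk x s ≤ ENNReal.ofReal (2 * Real.exp (-(β * x))) :=
  (parKernel_apply_le_of_notMem _ _ hs hxs).trans
    (lintegral_acceptedDensity_expDA_le hk hβk hβ hx)

theorem le_expDA_singleton {β : ℝ} (hβk : β ≤ |1 - k| / 2) (hβ : β ≤ 1 / 2)
    {x : ℝ} (hx : 0 < x) :
    ENNReal.ofReal (1 - 2 * Real.exp (-(β * x))) ≤ expDA k hk x {x} := by
  refine le_trans ?_ (le_parKernel_singleton _ _ x)
  rw [ENNReal.ofReal_sub _ (by positivity), ENNReal.ofReal_one]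
  exact tsub_le_tsub_left (lintegral_acceptedDensity_expDA_le hk hβk hβ hx) _

/-- This is where `k ≠ 1` enters: for `k = 1` there would be no decay. -/
theorem exists_decay_rate (hk1 : k ≠ 1) : ∃ β : ℝ, 0 < β ∧ β ≤ |1 - k| / 2 ∧ β ≤ 1 / 2 :=
  ⟨min (|1 - k| / 2) (1 / 2),
    lt_min (half_pos (abs_pos.2 (sub_ne_zero.2 hk1.symm))) one_half_pos, min_le_left _ _,
    min_le_right _ _⟩

theorem tendsto_two_mul_exp_neg_mul {β : ℝ} (hβ : 0 < β) :
    Tendsto (fun t : ℝ => 2 * Real.exp (-(β * t))) atTop (nhds 0) := by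
  have h := (Real.tendsto_exp_neg_atTop_nhds_zero.comp
    (tendsto_id.const_mul_atTop hβ)).const_mul 2
  simpa [Function.comp_def] using h

/-! ### Failure of conductance, geometric ergodicity and variance bounding. -/

theorem conductance_expDA (hk1 : k ≠ 1) : conductance (expDA k hk) expLaw = 0 := by
  obtain ⟨β, hβ0, hβk, hβ⟩ := exists_decay_rate hk1
  have hlim : Tendsto (fun t : ℝ => ENNReal.ofReal (2 * Real.exp (-(β * t)))) atTop (nhds 0) := by
    rw [← ENNReal.ofReal_zero]
    exact ENNReal.tendsto_ofReal (tendsto_two_mul_exp_neg_mul hβ0)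
  refine le_antisymm (ge_of_tendsto hlim ?_) zero_le
  -- `log 2` is the median of `expLaw`, so tails beyond it have mass at most `1 / 2`.
  filter_upwards [eventually_ge_atTop (Real.log 2)] with t ht
  have ht0 : 0 < t := (Real.log_pos one_lt_two).trans_le ht
  have hpos : 0 < expLaw (Set.Ioi t) := by
    rw [expLaw_Ioi ht0.le]
    exact ENNReal.ofReal_pos.2 (Real.exp_pos _)
  have hhalf : expLaw (Set.Ioi t) ≤ 1 / 2 := by
    have h2 : ENNReal.ofReal (1 / 2) = 1 / 2 := by
      rw [ENNReal.ofReal_div_of_pos two_pos, ENNReal.ofReal_one, ENNReal.ofReal_ofNat]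
    rw [expLaw_Ioi ht0.le, ← h2]
    refine ENNReal.ofReal_le_ofReal ?_
    rw [Real.exp_neg, one_div]
    exact inv_anti₀ two_pos ((Real.log_le_iff_le_exp two_pos).1 ht)
  have hle : conductance (expDA k hk) expLaw ≤ escapeProb (expDA k hk) expLaw (Set.Ioi t) := by
    unfold conductance
    exact iInf₂_le_of_le (Set.Ioi t) measurableSet_Ioi (iInf₂_le hpos hhalf)
  refine hle.trans ?_
  refine ENNReal.div_le_of_le_mul ?_
  rw [← setLIntegral_const]
  refine setLIntegral_mono' measurableSet_Ioi fun x hx => ?_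
  have hxt : t < x := hx
  refine (expDA_apply_le_of_notMem hk hβk hβ (ht0.trans hxt) measurableSet_Ioi.compl
    (fun h => h hx)).trans (ENNReal.ofReal_le_ofReal ?_)
  gcongr

theorem not_geometricallyErgodic_expDA (hk1 : k ≠ 1) :
    ¬ GeometricallyErgodic (expDA k hk) expLaw := by
  obtain ⟨β, hβ0, hβk, hβ⟩ := exists_decay_rate hk1
  refine not_geometricallyErgodic_of_sticky _ _ fun ρ hρ => ?_
  have hρ' : (0 : ℝ) < 1 - ρ := sub_pos.2 (by exact_mod_cast hρ)
  obtain ⟨t, ht, ht0⟩ := (((tendsto_two_mul_exp_neg_mul hβ0).eventually_lt_const hρ').and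
    (eventually_ge_atTop 0)).exists
  refine ⟨Set.Ioi t, ?_, fun x hx => ?_⟩
  · rw [expLaw_Ioi ht0]
    exact (ENNReal.ofReal_pos.2 (Real.exp_pos _)).ne'
  · have hxt : t < x := hx
    refine lt_of_lt_of_le ?_ (le_expDA_singleton hk hβk hβ (ht0.trans_lt hxt))
    have hmono : 2 * Real.exp (-(β * x)) ≤ 2 * Real.exp (-(β * t)) := by gcongr
    rw [← ENNReal.ofReal_coe_nnreal]
    exact (ENNReal.ofReal_lt_ofReal_iff (by linarith [ρ.2])).2 (by linarith)

theorem memLp_exp_mul_expLaw {γ : ℝ} (hγ : γ < 1 / 2) :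
    MemLp (fun x => Real.exp (γ * x)) 2 expLaw := by
  rw [memLp_two_iff_integrable_sq (by fun_prop), expLaw, ProbDensity.measure,
    integrable_withDensity_iff (expDensity 1 one_pos).measurable.ennreal_ofReal
      (ae_of_all _ fun x => ENNReal.ofReal_lt_top)]
  have h := (integrableOn_exp_mul_Ioi (a := 2 * γ - 1) (by linarith) 0).integrable_indicator
    measurableSet_Ioi
  refine h.congr (ae_of_all _ fun x => ?_)
  simp only [ENNReal.toReal_ofReal ((expDensity 1 one_pos).nonneg x)]
  by_cases hx : x ∈ Set.Ioi (0 : ℝ)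
  · rw [Set.indicator_of_mem hx, expDensity_one_dens_of_pos hx, ← Real.exp_nat_mul, ← Real.exp_add]
    congr 1
    push_cast
    ring
  · rw [Set.indicator_of_notMem hx, expDensity_dens_of_nonpos _ (not_lt.1 hx), mul_zero]

/-- The function `x ↦ exp (γ x)`, with `γ < 1 / 2` close enough to `1 / 2`, has infinite
asymptotic variance: the chain is unlikely to leave the tail within `n` steps. -/
theorem asymptoticVariance_expDA_exp {β : ℝ} (hβ0 : 0 < β) (hβk : β ≤ |1 - k| / 2)
    (hβ : β ≤ 1 / 2) :
    asymptoticVariance (expDA k hk) expLaw (fun x => Real.exp ((1 / 2 - β / 4) * x)) = ⊤ := by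
  set γ : ℝ := 1 / 2 - β / 4 with hγ
  have hγ0 : 0 < γ := by linarith
  set h : ℝ → ℝ := fun x => Real.exp (γ * x) with hh
  have hint : Integrable h expLaw :=
    (memLp_exp_mul_expLaw (γ := γ) (by linarith)).integrable one_le_two
  set m : ℝ := ∫ x, h x ∂expLaw with hm
  refine Tendsto.limsup_eq ?_
  -- The number of samples becomes `n + 1`, which is never 0.
  rw [← tendsto_add_atTop_iff_nat 1]
  have hn : Tendsto (fun n : ℕ => (n : ℝ) + 1) atTop atTop :=
    tendsto_atTop_add_const_right _ _ tendsto_natCast_atTop_atTop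
  -- This level makes the moving probability `2 exp (-β t)` equal to `1 / (2 (n + 1))`.
  set t : ℕ → ℝ := fun n => Real.log (4 * ((n : ℝ) + 1)) / β with ht
  have htlim : Tendsto t atTop atTop :=
    (Real.tendsto_log_atTop.comp (hn.const_mul_atTop four_pos)).atTop_div_const hβ0
  have hhlim : Tendsto (fun n => h (t n)) atTop atTop :=
    Real.tendsto_exp_atTop.comp (htlim.const_mul_atTop hγ0)
  have hlow : Tendsto (fun n : ℕ => ENNReal.ofReal (Real.sqrt ((n : ℝ) + 1) / 16)) atTop
      (nhds ⊤) :=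
    ENNReal.tendsto_ofReal_atTop.comp
      ((Real.tendsto_sqrt_atTop.comp hn).atTop_div_const (by norm_num))
  refine tendsto_nhds_top_mono hlow ?_
  filter_upwards [htlim.eventually_ge_atTop 0, hhlim.eventually_ge_atTop (2 * m)] with n ht0 hmn
  have hN : (0 : ℝ) < 4 * ((n : ℝ) + 1) := by positivity
  have hexp : Real.exp (-(β * t n)) = (4 * ((n : ℝ) + 1))⁻¹ := by
    rw [ht]
    simp only
    rw [mul_div_cancel₀ _ hβ0.ne', Real.exp_neg, Real.exp_log hN]
  have hstay : ∀ x ∈ Set.Ioi (t n),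
      ENNReal.ofReal (1 - (2 * ((n : ℝ) + 1))⁻¹) ≤ expDA k hk x {x} := by
    intro x hx
    have hx' : t n < x := hx
    refine le_trans (ENNReal.ofReal_le_ofReal ?_)
      (le_expDA_singleton hk hβk hβ (ht0.trans_lt hx'))
    have h1 : 2 * Real.exp (-(β * x)) ≤ 2 * Real.exp (-(β * t n)) := by gcongr
    have h2 : 2 * (4 * ((n : ℝ) + 1))⁻¹ = (2 * ((n : ℝ) + 1))⁻¹ := by
      field_simp
      norm_num
    rw [hexp, h2] at h1
    linarith
  have hfar : ∀ x ∈ Set.Ioi (t n), h (t n) / 2 ≤ h x - m := by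
    intro x hx
    have hx' : t n < x := hx
    have : h (t n) ≤ h x := Real.exp_le_exp.2 (by gcongr)
    linarith
  have hvar := le_evariance_mean_of_sticky (expDA_isReversible hk).invariant hint
    measurableSet_Ioi hstay hfar n
  have hb : (0 : ℝ) ≤ 1 - (2 * ((n : ℝ) + 1))⁻¹ := by
    rw [sub_nonneg]
    exact inv_le_one_of_one_le₀ (by linarith [n.cast_nonneg (α := ℝ)])
  -- By Bernoulli's inequality, a start above `t n` stays frozen for `n` steps with probability at
  -- least `1 / 2`.
  have hpow : (1 / 2 : ℝ) ≤ (1 - (2 * ((n : ℝ) + 1))⁻¹) ^ n := by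
    have hB := one_add_mul_le_pow (a := -(2 * ((n : ℝ) + 1))⁻¹) (by linarith) n
    rw [← sub_eq_add_neg] at hB
    refine le_trans ?_ hB
    have : (n : ℝ) * (2 * ((n : ℝ) + 1))⁻¹ ≤ 1 / 2 := by
      rw [← div_eq_mul_inv, div_le_iff₀ (by positivity)]
      linarith
    linarith
  refine le_trans ?_ (mul_le_mul_right hvar _)
  rw [expLaw_Ioi ht0, ← ENNReal.ofReal_pow (by positivity), ← ENNReal.ofReal_pow hb,
    ← ENNReal.ofReal_mul (by positivity), ← ENNReal.ofReal_mul (by positivity),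
    ← ENNReal.ofReal_natCast, ← ENNReal.ofReal_mul (by positivity)]
  refine ENNReal.ofReal_le_ofReal ?_
  -- Since `2 γ - 1 = -β / 2`, the left side is `exp (-β t / 2)`, the square root of the quantity in
  -- `hexp`. This choice of `γ` loses only `√(n + 1)` against the factor `n + 1`.
  have hroot : (h (t n)) ^ 2 * Real.exp (-t n) = (2 * Real.sqrt ((n : ℝ) + 1))⁻¹ := by
    have hsq : ((h (t n)) ^ 2 * Real.exp (-t n)) ^ 2 = (4 * ((n : ℝ) + 1))⁻¹ := by
      rw [← hexp, hh, ← Real.exp_nat_mul, ← Real.exp_add, ← Real.exp_nat_mul, hγ]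
      congr 1
      push_cast
      ring
    have hsq' : ((2 * Real.sqrt ((n : ℝ) + 1))⁻¹) ^ 2 = (4 * ((n : ℝ) + 1))⁻¹ := by
      rw [inv_pow, mul_pow, Real.sq_sqrt (by positivity)]
      norm_num
    exact (pow_left_inj₀ (by positivity) (by positivity) two_ne_zero).1 (hsq.trans hsq'.symm)
  have hsqrt : Real.sqrt ((n : ℝ) + 1) / 16 =
      ((n : ℝ) + 1) * ((2 * Real.sqrt ((n : ℝ) + 1))⁻¹ / 8) := by
    have hs : Real.sqrt ((n : ℝ) + 1) ≠ 0 := by positivity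
    field_simp
    rw [Real.sq_sqrt (by positivity)]
    ring
  rw [hsqrt, ← hroot]
  push_cast
  gcongr
  calc h (t n) ^ 2 * Real.exp (-t n) / 8 = (h (t n) / 2) ^ 2 * (1 / 2 * Real.exp (-t n)) := by ring
    _ ≤ _ := by gcongr

end DelayedAcceptance

theorem mainTheorem12 (k : ℝ) (hk : 0 < k) (hk1 : k ≠ 1) :
    DelayedAcceptance.expMH.IsReversible DelayedAcceptance.expLaw ∧
      (DelayedAcceptance.expDA k hk).IsReversible DelayedAcceptance.expLaw ∧
      DelayedAcceptance.GeometricallyErgodic DelayedAcceptance.expMH DelayedAcceptance.expLaw ∧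
      DelayedAcceptance.conductance (DelayedAcceptance.expDA k hk) DelayedAcceptance.expLaw = 0 ∧
      ¬ DelayedAcceptance.GeometricallyErgodic (DelayedAcceptance.expDA k hk)
        DelayedAcceptance.expLaw ∧
      ¬ DelayedAcceptance.VarianceBounding (DelayedAcceptance.expDA k hk)
        DelayedAcceptance.expLaw := by
  refine ⟨?_, DelayedAcceptance.expDA_isReversible hk,
    DelayedAcceptance.geometricallyErgodic_of_apply_eq _ _ DelayedAcceptance.expMH_apply,
    DelayedAcceptance.conductance_expDA hk hk1,
    DelayedAcceptance.not_geometricallyErgodic_expDA hk hk1, fun hvb => ?_⟩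
  · intro A B _ _
    simp_rw [DelayedAcceptance.expMH_apply]
    rw [setLIntegral_const, setLIntegral_const, mul_comm]
  · obtain ⟨β, hβ0, hβk, hβ⟩ := DelayedAcceptance.exists_decay_rate hk1
    exact (hvb _ (DelayedAcceptance.memLp_exp_mul_expLaw (by linarith))).ne
      (DelayedAcceptance.asymptoticVariance_expDA_exp hk hβ0 hβk hβ)
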